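/- Let $N, M \ge 1$ be integers, and fix integers $0 \le \xi_0 < \xi_1 < \dots < \xi_{N-1}$ and positive integers $\lambda_0, \dots, \lambda_{M-1}$. For a real number $\lambda$ let $D_\lambda = \operatorname{diag}(e^{2\pi i\lambda\xi_0}, \dots, e^{2\pi i\lambda\xi_{N-1}})$, and let $T$ be the $N\times N$ cyclic shift matrix, $T(x_0,\dots,x_{N-1}) = (x_1,\dots,x_{N-1},x_0)$. There is an integer $d$, depending only on $\xi_0,\dots,\xi_{N-1}$ and $\lambda_0,\dots,\lambda_{M-1}$, such that the following holds for every real number $\tau$ with $0 \le \tau\lambda_0 < \tau\lambda_1 < \dots < \tau\lambda_{M-1}$. Put $\Lambda_\tau = \{\tau\lambda_0, \dots, \tau\lambda_{M-1}\}$. If $e^{2\pi i\tau}$ is either transcendental, or algebraic over $\mathbb{Q}$ of degree at least $d$, then there exists a nonzero vector $f \in \mathbb{C}^N$ such that the collection $\{D_\lambda T^\kappa f : \lambda \in \Lambda_\tau,\ \kappa \in \mathbb{Z}_N\}$ (a family indexed by $\Lambda_\tau \times \mathbb{Z}_N$) is a full spark frame for $\mathbb{C}^N$. Here a finite family $(v_k)_{k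 \in I}$ in $\mathbb{C}^N$ is called a full spark frame if it is a frame, i.e. there are constants $0 < A \le B$ with $A\|w\|^2 \le \sum_{k\in I} |\langle w, v_k\rangle|^2 \le B\|w\|^2$ for all $w \in \mathbb{C}^N$, and any $N$ of its members (at $N$ different indices) form a basis of $\mathbb{C}^N$. -/

import Mathlib

open scoped Matrix

/-- A finite family `v` of vectors of a Hilbert space `H` is a frame if there are positive reals
`A ≤ B` with `A ‖w‖² ≤ ∑ₖ |⟨w, vₖ⟩|² ≤ B ‖w‖²` for all `w`. -/
def IsFrame {H ι : Type*} [NormedAddCommGroup H] [InnerProductSpace ℂ H] [Fintype ι]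
    (v : ι → H) : Prop :=
  ∃ A B : ℝ, 0 < A ∧ A ≤ B ∧ ∀ w : H,
    A * ‖w‖ ^ 2 ≤ ∑ k, ‖inner ℂ w (v k)‖ ^ 2 ∧ ∑ k, ‖inner ℂ w (v k)‖ ^ 2 ≤ B * ‖w‖ ^ 2

/-- A finite family in a finite-dimensional Hilbert space `H` is a full spark frame if it is a
frame and any `dim H` of its members (chosen at different indices) form a basis of `H`. -/
def IsFullSparkFrame {H ι : Type*} [NormedAddCommGroup H] [InnerProductSpace ℂ H] [Fintype ι]
    (v : ι → H) : Prop :=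
  IsFrame v ∧ ∀ s : Finset ι, s.card = Module.finrank ℂ H →
    LinearIndependent ℂ (fun k : s => v k) ∧
      Submodule.span ℂ (Set.range fun k : s => v k) = ⊤

/-- The cyclic shift matrix: `(T x)ᵢ = xᵢ₊₁`, the indices being taken modulo `N`. -/
def shiftMatrix (N : ℕ) : Matrix (Fin N) (Fin N) ℂ :=
  Matrix.of fun i j => if (j : ℕ) = ((i : ℕ) + 1) % N then 1 else 0

/-- The diagonal unitary matrix `D_x = diag(e^{2πi x ξ₀}, …, e^{2πi x ξ_{N-1}})`, for real `x`. -/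
noncomputable def modMatrix {N : ℕ} (ξ : Fin N → ℕ) (x : ℝ) : Matrix (Fin N) (Fin N) ℂ :=
  Matrix.diagonal fun j => Complex.exp (2 * Real.pi * Complex.I * (x : ℂ) * (ξ j : ℂ))

/-- The finite set of reals `Λ_τ = {τ l₀, …, τ l_{M-1}}`. -/
noncomputable def modSet {M : ℕ} (τ : ℝ) (l : Fin M → ℕ) : Finset ℝ :=
  Finset.univ.image fun j => τ * (l j : ℝ)

/-- The family `D_x T^κ f`, indexed by `x ∈ Λ` and `κ ∈ ℤ/N`.
Since `T ^ N = 1`, the power `T^κ` is computed from the representative `κ.val` in `{0, …, N-1}`. -/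
noncomputable def modShiftFamily {N : ℕ} (ξ : Fin N → ℕ) (Λ : Finset ℝ)
    (f : EuclideanSpace ℂ (Fin N)) : Λ × ZMod N → EuclideanSpace ℂ (Fin N) :=
  fun p => WithLp.toLp 2 ((modMatrix ξ (p.1 : ℝ) * shiftMatrix N ^ p.2.val) *ᵥ f.ofLp)

/-! Write `z` for `e^{2πiτ}`. Each `N × N` minor of the family is a polynomial in `z` and the
coordinates of `f`, and it is not identically zero (`genericMinor_ne_zero`). Indeed, by the
rearrangement inequality, its top coefficient in `z` is, up to sign, a product of minors of a
generic circulant matrix. Those are nonzero because a specialisation at powers of a root of unity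
factors them into two Vandermonde determinants. So each minor has a nonzero coefficient in `ℚ[z]`.
If `z` is transcendental or of degree larger than those of these finitely many coefficients, every
minor remains a nonzero polynomial in `f`, and one `f` avoids all their zero sets. -/

open Matrix Polynomial in
/-- The coefficient of highest possible degree in the determinant of a matrix with entries
`X ^ (a i * b j) * g i j`, with `a` strictly increasing and `b` increasing, is the determinant of
the block diagonal part of `g` along the level sets of `b`. -/
theorem coeff_det_X_pow_mul {R : Type*} [CommRing R] {n : ℕ} {a b : Fin n → ℕ}
    (ha : StrictMono a) (hb : Monotone b) (g : Fin n → Fin n → R) :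
    (Matrix.det (Matrix.of fun i j => (X : R[X]) ^ (a i * b j) * C (g i j))).coeff
      (∑ i, a i * b i) = Matrix.det (Matrix.of fun i j => if b i = b j then g i j else 0) := by
  rw [Matrix.det_apply', Matrix.det_apply', finsetSum_coeff]
  refine Finset.sum_congr rfl fun σ _ => ?_
  have key : (∑ i, a (σ i) * b i = ∑ i, a i * b i) ↔ ∀ i, b (σ i) = b i := by
    constructor
    · intro h
      -- Equality in the rearrangement inequality makes `a ∘ σ` monovary with `b`; since `a` is
      -- strict, `b ∘ σ⁻¹` is sorted, hence equal to `b`.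
      have hm : Monovary a b := ha.monotone.monovary hb
      rw [hm.sum_comp_perm_mul_eq_sum_mul_iff] at h
      have hmono : Monotone (b ∘ (σ⁻¹ : Equiv.Perm (Fin n))) := by
        intro i j hij
        by_contra hlt
        have h1 := h (not_le.mp hlt)
        simp only [Function.comp_apply, Equiv.Perm.coe_inv, Equiv.apply_symm_apply] at h1
        have h2 : j ≤ i := ha.le_iff_le.mp h1
        rw [le_antisymm hij h2] at hlt
        exact hlt le_rfl
      have hun := Tuple.unique_monotone (f := b) (σ := σ⁻¹) (τ := 1) hmono (by simpa using hb)
      intro i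
      have := congrFun hun (σ i)
      simpa using this.symm
    · intro h
      rw [← Equiv.sum_comp σ (fun i => a i * b i)]
      exact Finset.sum_congr rfl fun i _ => by rw [h i]
  have hprod : ∏ i, (Matrix.of fun i j => (X : R[X]) ^ (a i * b j) * C (g i j)) (σ i) i
      = C (∏ i, g (σ i) i) * X ^ (∑ i, a (σ i) * b i) := by
    simp only [Matrix.of_apply]
    rw [Finset.prod_mul_distrib, Finset.prod_pow_eq_pow_sum, map_prod, mul_comm]
  have hsign : (((Equiv.Perm.sign σ : ℤ) : R[X])) = C ((Equiv.Perm.sign σ : ℤ) : R) := by simp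
  rw [hprod, hsign, coeff_C_mul, coeff_C_mul, coeff_X_pow]
  congr 1
  simp only [Matrix.of_apply]
  by_cases h : ∀ i, b (σ i) = b i
  · simp [h, key.mpr h]
  · rw [if_neg fun h' => h (key.mp h'.symm), mul_zero]
    push Not at h
    obtain ⟨i, hi⟩ := h
    exact (Finset.prod_eq_zero (Finset.mem_univ i) (if_neg hi)).symm

open Matrix in
/-- If `x` and `y` are injective then the matrix of the power sums `∑ a < n, (x i * y j) ^ a` of
length the size `n` of the matrix is nonsingular. -/
theorem det_sum_pow_ne_zero {K ι : Type*} [Field K] [Fintype ι] [DecidableEq ι] {x y : ι → K}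
    (hx : Function.Injective x) (hy : Function.Injective y) :
    Matrix.det (Matrix.of fun i j => ∑ a : Fin (Fintype.card ι), (x i * y j) ^ (a : ℕ)) ≠ 0 := by
  let e := Fintype.equivFin ι
  have h : (Matrix.of fun i j => ∑ a : Fin (Fintype.card ι), (x i * y j) ^ (a : ℕ)) =
      (vandermonde (x ∘ e.symm) * (vandermonde (y ∘ e.symm))ᵀ).submatrix e e := by
    ext i j
    simp [Matrix.mul_apply, vandermonde_apply, mul_pow]
  rw [h, det_submatrix_equiv_self, det_mul, det_transpose]
  exact mul_ne_zero (det_vandermonde_ne_zero_iff.mpr (hx.comp e.symm.injective))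
    (det_vandermonde_ne_zero_iff.mpr (hy.comp e.symm.injective))

/-- The index `j + k` modulo `N`. -/
def cyclicAdd {N : ℕ} [NeZero N] (j : Fin N) (k : ZMod N) : Fin N :=
  ⟨((j : ℕ) + k.val) % N, Nat.mod_lt _ (NeZero.pos N)⟩

/-- All minors of the generic circulant matrix are nonzero polynomials. -/
theorem det_X_cyclicAdd_ne_zero {N : ℕ} [NeZero N] {ι : Type*} [Fintype ι] [DecidableEq ι]
    {r : ι → Fin N} {k : ι → ZMod N} (hr : Function.Injective r) (hk : Function.Injective k) :
    Matrix.det (Matrix.of fun i j =>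
      (MvPolynomial.X (cyclicAdd (r i) (k j)) : MvPolynomial (Fin N) ℂ)) ≠ 0 := by
  have hN : N ≠ 0 := NeZero.ne N
  obtain ⟨ω, hω⟩ : ∃ ω : ℂ, IsPrimitiveRoot ω N := ⟨_, Complex.isPrimitiveRoot_exp N hN⟩
  intro h
  -- As `ω ^ N = 1`, this specialisation turns addition of indices modulo `N` into a product `ω ^ r
  -- i * ω ^ k j`.
  have h' := congrArg (MvPolynomial.eval fun x : Fin N =>
    ∑ a : Fin (Fintype.card ι), (ω ^ (x : ℕ)) ^ (a : ℕ)) h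
  rw [RingHom.map_det, map_zero] at h'
  refine det_sum_pow_ne_zero (x := fun i => ω ^ (r i : ℕ)) (y := fun i => ω ^ (k i).val)
    ?_ ?_ ?_
  · intro i j hij
    exact hr (Fin.ext (hω.pow_inj (r i).2 (r j).2 hij))
  · intro i j hij
    exact hk (ZMod.val_injective N (hω.pow_inj (ZMod.val_lt _) (ZMod.val_lt _) hij))
  · rw [← h']
    congr 1
    ext i j
    simp only [Matrix.of_apply, RingHom.mapMatrix_apply, Matrix.map_apply, MvPolynomial.eval_X,
      cyclicAdd]
    refine Finset.sum_congr rfl fun a _ => ?_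
    rw [← pow_add, ← pow_mod_orderOf ω (_ + _), ← hω.eq_orderOf]

open Polynomial in
/-- The determinant of `N` members of the family `D_x T^κ f`, the coordinates of `f` and the number
`e^{2πiτ}` being replaced by indeterminates. -/
noncomputable def genericMinor {N M : ℕ} [NeZero N] (ξ : Fin N → ℕ) (l : Fin M → ℕ)
    (c : Fin N → Fin M × ZMod N) : MvPolynomial (Fin N) ℚ[X] :=
  Matrix.det (Matrix.of fun i j => MvPolynomial.C (X ^ (ξ i * l (c j).1)) *
    MvPolynomial.X (cyclicAdd i (c j).2))

-- Each diagonal block of the top coefficient in `X` lies over one value of `l`. Within it the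
-- shifts are distinct, since `c` and `l` are injective, so the block is a generic circulant minor.
open Polynomial in
theorem genericMinor_ne_zero_of_monotone {N M : ℕ} [NeZero N] {ξ : Fin N → ℕ} (hξ : StrictMono ξ)
    {l : Fin M → ℕ} (hl : Function.Injective l) {c : Fin N → Fin M × ZMod N}
    (hc : Function.Injective c) (hm : Monotone fun j => l (c j).1) :
    genericMinor ξ l c ≠ 0 := by
  intro h
  let φ : MvPolynomial (Fin N) ℚ[X] →+* (MvPolynomial (Fin N) ℂ)[X] :=
    MvPolynomial.eval₂Hom (Polynomial.mapRingHom (algebraMap ℚ (MvPolynomial (Fin N) ℂ)))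
      (fun i => C (MvPolynomial.X i))
  have h1 := congrArg φ h
  rw [genericMinor, RingHom.map_det, map_zero] at h1
  have h2 : φ.mapMatrix (Matrix.of fun i j => MvPolynomial.C (X ^ (ξ i * l (c j).1)) *
      MvPolynomial.X (cyclicAdd i (c j).2)) = Matrix.of fun i j =>
        (X : (MvPolynomial (Fin N) ℂ)[X]) ^ (ξ i * l (c j).1) *
          C (MvPolynomial.X (cyclicAdd i (c j).2)) := by
    ext1 i j
    simp [φ]
  rw [h2] at h1
  have h3 := coeff_det_X_pow_mul hξ hm
    (fun i j => (MvPolynomial.X (cyclicAdd i (c j).2) : MvPolynomial (Fin N) ℂ))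
  rw [h1, coeff_zero] at h3
  have hbt : Matrix.BlockTriangular (Matrix.of fun i j => if l (c i).1 = l (c j).1 then
      (MvPolynomial.X (cyclicAdd i (c j).2) : MvPolynomial (Fin N) ℂ) else 0)
      (fun j => l (c j).1) := by
    intro i j hij
    simp [hij.ne']
  rw [hbt.det, eq_comm, Finset.prod_eq_zero_iff] at h3
  obtain ⟨v, -, hv⟩ := h3
  refine det_X_cyclicAdd_ne_zero (r := fun i : {j // l (c j).1 = v} => (i : Fin N))
    (k := fun i : {j // l (c j).1 = v} => (c i).2) Subtype.val_injective ?_ ?_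
  · intro i j hij
    exact Subtype.ext (hc (Prod.ext (hl (i.2.trans j.2.symm)) hij))
  · rw [← hv]
    congr 1
    ext1 i j
    simp [Matrix.toSquareBlock_def, i.2, j.2]

theorem genericMinor_ne_zero {N M : ℕ} [NeZero N] {ξ : Fin N → ℕ} (hξ : StrictMono ξ)
    {l : Fin M → ℕ} (hl : Function.Injective l) {c : Fin N → Fin M × ZMod N}
    (hc : Function.Injective c) : genericMinor ξ l c ≠ 0 := by
  -- Sorting the columns changes the determinant only by a sign.
  let σ := Tuple.sort fun j => l (c j).1
  have h := genericMinor_ne_zero_of_monotone hξ hl (hc.comp σ.injective)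
    (Tuple.monotone_sort fun j => l (c j).1)
  intro h0
  apply h
  have h1 := Matrix.det_permute' σ (Matrix.of fun i j =>
    (MvPolynomial.C ((Polynomial.X : Polynomial ℚ) ^ (ξ i * l (c j).1)) *
      MvPolynomial.X (cyclicAdd i (c j).2) : MvPolynomial (Fin N) (Polynomial ℚ)))
  rw [← genericMinor, h0, mul_zero] at h1
  exact h1

/-- A finite spanning family of a finite-dimensional Hilbert space is a frame. -/
theorem isFrame_of_span_eq_top {H ι : Type*} [NormedAddCommGroup H] [InnerProductSpace ℂ H]
    [FiniteDimensional ℂ H] [Fintype ι] {v : ι → H}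
    (hv : Submodule.span ℂ (Set.range v) = ⊤) : IsFrame v := by
  -- The analysis operator: its injectivity yields the lower frame bound.
  let L : H →ₗ[ℂ] EuclideanSpace ℂ ι :=
    { toFun := fun w => WithLp.toLp 2 fun k => inner ℂ (v k) w
      map_add' := fun x y => by ext k; simp
      map_smul' := fun r x => by ext k; simp }
  have hL : ∀ w, ‖L w‖ ^ 2 = ∑ k, ‖inner ℂ w (v k)‖ ^ 2 := by
    intro w
    rw [EuclideanSpace.norm_sq_eq]
    exact Finset.sum_congr rfl fun k _ => by
      rw [norm_inner_symm]
      rfl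
  have hker : LinearMap.ker L = ⊥ := by
    rw [LinearMap.ker_eq_bot']
    intro w hw
    have h0 : ∀ u ∈ Submodule.span ℂ (Set.range v), inner ℂ u w = 0 := by
      intro u hu
      induction hu using Submodule.span_induction with
      | mem x hx =>
        obtain ⟨k, rfl⟩ := hx
        exact congrFun (congrArg WithLp.ofLp hw) k
      | zero => simp
      | add x y _ _ hx hy => rw [inner_add_left, hx, hy, add_zero]
      | smul r x _ hx => rw [inner_smul_left, hx, mul_zero]
    exact inner_self_eq_zero.mp (h0 w (hv ▸ Submodule.mem_top))
  obtain ⟨K, hK, hanti⟩ := L.exists_antilipschitzWith hker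
  have hKpos : (0 : ℝ) < K := by exact_mod_cast hK
  refine ⟨(K : ℝ)⁻¹ ^ 2, max ((K : ℝ)⁻¹ ^ 2) (∑ k, ‖v k‖ ^ 2), by positivity, le_max_left _ _,
    fun w => ⟨?_, ?_⟩⟩
  · rw [← hL, ← mul_pow]
    have h := hanti.le_mul_dist w 0
    rw [map_zero, dist_zero_right, dist_zero_right] at h
    have : (K : ℝ)⁻¹ * ‖w‖ ≤ ‖L w‖ := by
      rw [inv_mul_le_iff₀ hKpos]
      exact h
    gcongr
  · calc ∑ k, ‖inner ℂ w (v k)‖ ^ 2 ≤ ∑ k, ‖v k‖ ^ 2 * ‖w‖ ^ 2 := by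
          refine Finset.sum_le_sum fun k _ => ?_
          rw [← mul_pow, mul_comm ‖v k‖]
          gcongr
          exact norm_inner_le_norm _ _
      _ = (∑ k, ‖v k‖ ^ 2) * ‖w‖ ^ 2 := by rw [Finset.sum_mul]
      _ ≤ _ := by gcongr; exact le_max_right _ _

/-- A family with at least `dim H` members, any `dim H` of which are linearly independent, is a
full spark frame. -/
theorem isFullSparkFrame_of_linearIndependent {H ι : Type*} [NormedAddCommGroup H]
    [InnerProductSpace ℂ H] [FiniteDimensional ℂ H] [Fintype ι] {v : ι → H}
    (hcard : Module.finrank ℂ H ≤ Fintype.card ι)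
    (h : ∀ s : Finset ι, s.card = Module.finrank ℂ H →
      LinearIndependent ℂ (fun k : s => v k)) : IsFullSparkFrame v := by
  have hs : ∀ s : Finset ι, s.card = Module.finrank ℂ H →
      Submodule.span ℂ (Set.range fun k : s => v k) = ⊤ := fun s hs =>
    (h s hs).span_eq_top_of_card_eq_finrank' (by rw [Fintype.card_coe, hs])
  refine ⟨isFrame_of_span_eq_top ?_, fun s hc => ⟨h s hc, hs s hc⟩⟩
  obtain ⟨s, -, hc⟩ := Finset.exists_subset_card_eq (s := (Finset.univ : Finset ι)) hcard
  rw [eq_top_iff, ← hs s hc]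
  refine Submodule.span_mono ?_
  rintro _ ⟨k, rfl⟩
  exact ⟨k, rfl⟩

open scoped Matrix in
theorem shiftMatrix_mulVec {N : ℕ} [NeZero N] (f : Fin N → ℂ) (j : Fin N) :
    (shiftMatrix N *ᵥ f) j = f ⟨((j : ℕ) + 1) % N, Nat.mod_lt _ (NeZero.pos N)⟩ := by
  rw [Matrix.mulVec, dotProduct, Finset.sum_eq_single
    (⟨((j : ℕ) + 1) % N, Nat.mod_lt _ (NeZero.pos N)⟩ : Fin N)]
  · simp [shiftMatrix]
  · intro b _ hb
    have : (b : ℕ) ≠ ((j : ℕ) + 1) % N := fun h => hb (Fin.ext h)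
    simp [shiftMatrix, this]
  · simp

open scoped Matrix in
theorem shiftMatrix_pow_mulVec {N : ℕ} [NeZero N] (k : ℕ) (f : Fin N → ℂ) (j : Fin N) :
    (shiftMatrix N ^ k *ᵥ f) j = f ⟨((j : ℕ) + k) % N, Nat.mod_lt _ (NeZero.pos N)⟩ := by
  induction k generalizing f with
  | zero => simp [Nat.mod_eq_of_lt j.2]
  | succ k ih =>
    rw [pow_succ, ← Matrix.mulVec_mulVec, ih, shiftMatrix_mulVec]
    congr 2
    simp [add_assoc]

theorem modShiftFamily_apply {N : ℕ} [NeZero N] (ξ : Fin N → ℕ) (Λ : Finset ℝ)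
    (f : EuclideanSpace ℂ (Fin N)) (p : Λ × ZMod N) (j : Fin N) :
    modShiftFamily ξ Λ f p j =
      Complex.exp (2 * Real.pi * Complex.I * ((p.1 : ℝ) : ℂ) * (ξ j : ℂ)) *
        f (cyclicAdd j p.2) := by
  simp only [modShiftFamily, modMatrix]
  rw [← Matrix.mulVec_mulVec, Matrix.mulVec_diagonal, shiftMatrix_pow_mulVec]
  rfl

open Polynomial in
/-- A number that is transcendental or of large degree is not a root of a rational polynomial. -/
theorem aeval_ne_zero_of_natDegree_lt {z : ℂ} {d : ℕ}
    (hz : Transcendental ℚ z ∨ (IsAlgebraic ℚ z ∧ d ≤ (minpoly ℚ z).natDegree))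
    {q : ℚ[X]} (hq : q ≠ 0) (hd : q.natDegree < d) : aeval z q ≠ 0 := by
  intro h
  rcases hz with hz | ⟨-, hz⟩
  · exact hz ⟨q, hq, h⟩
  · exact absurd (natDegree_le_of_dvd (minpoly.dvd ℚ z h) hq) (by omega)

open Polynomial in
theorem eval_map_genericMinor {N M : ℕ} [NeZero N] (ξ : Fin N → ℕ) (l : Fin M → ℕ)
    (c : Fin N → Fin M × ZMod N) (z : ℂ) (f : Fin N → ℂ) :
    MvPolynomial.eval f (MvPolynomial.map (aeval (R := ℚ) z).toRingHom (genericMinor ξ l c)) =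
      Matrix.det (Matrix.of fun i j => z ^ (ξ i * l (c j).1) * f (cyclicAdd i (c j).2)) := by
  rw [genericMinor, RingHom.map_det, RingHom.map_det]
  congr 1
  ext i j
  simp

theorem mainTheorem4 (N M : ℕ) [NeZero N] [NeZero M]
    (ξ : Fin N → ℕ) (hξ : StrictMono ξ)
    (l : Fin M → ℕ) (hl : ∀ j, 0 < l j) :
    ∃ d : ℕ, ∀ τ : ℝ,
      (∀ j, 0 ≤ τ * (l j : ℝ)) → StrictMono (fun j => τ * (l j : ℝ)) →
      (Transcendental ℚ (Complex.exp (2 * Real.pi * Complex.I * (τ : ℂ))) ∨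
        (IsAlgebraic ℚ (Complex.exp (2 * Real.pi * Complex.I * (τ : ℂ))) ∧
          d ≤ (minpoly ℚ (Complex.exp (2 * Real.pi * Complex.I * (τ : ℂ)))).natDegree)) →
      ∃ f : EuclideanSpace ℂ (Fin N), f ≠ 0 ∧
        IsFullSparkFrame (modShiftFamily ξ (modSet τ l) f) := by
  by_cases hinj : Function.Injective l
  swap
  · refine ⟨0, fun τ _ hτ _ => absurd (fun i j hij => hτ.injective ?_) hinj⟩
    simp only [hij]
  have hex : ∀ c : {c : Fin N → Fin M × ZMod N // Function.Injective c},
      ∃ s, (genericMinor ξ l c).coeff s ≠ 0 := fun c =>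
    MvPolynomial.ne_zero_iff.mp (genericMinor_ne_zero hξ hinj c.2)
  choose s hs using hex
  -- The sum dominates every chosen degree, and the `1` makes the bound strict.
  refine ⟨1 + ∑ c, ((genericMinor ξ l c.1).coeff (s c)).natDegree, fun τ _ _ hz => ?_⟩
  set z := Complex.exp (2 * Real.pi * Complex.I * (τ : ℂ)) with hzdef
  let P : {c : Fin N → Fin M × ZMod N // Function.Injective c} → MvPolynomial (Fin N) ℂ :=
    fun c => MvPolynomial.map (Polynomial.aeval (R := ℚ) z).toRingHom (genericMinor ξ l c)
  have hP : ∀ c, P c ≠ 0 := by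
    intro c h
    have h1 := congrArg (MvPolynomial.coeff (s c)) h
    rw [MvPolynomial.coeff_map, MvPolynomial.coeff_zero] at h1
    refine aeval_ne_zero_of_natDegree_lt hz (hs c) ?_ h1
    have := Finset.single_le_sum (f := fun c => ((genericMinor ξ l c.1).coeff (s c)).natDegree)
      (fun _ _ => Nat.zero_le _) (Finset.mem_univ c)
    omega
  -- The extra factor `X 0` forces `f ≠ 0`.
  have hne : (MvPolynomial.X 0 * ∏ c, P c : MvPolynomial (Fin N) ℂ) ≠ 0 :=
    mul_ne_zero (MvPolynomial.X_ne_zero _) (Finset.prod_ne_zero_iff.mpr fun c _ => hP c)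
  obtain ⟨f, hf⟩ : ∃ f, MvPolynomial.eval f (MvPolynomial.X 0 * ∏ c, P c) ≠ 0 := by
    by_contra! h
    exact hne (MvPolynomial.funext fun f => by rw [h f, map_zero])
  rw [map_mul, MvPolynomial.eval_X, map_prod] at hf
  have hf0 := left_ne_zero_of_mul hf
  have hfP := fun c => Finset.prod_ne_zero_iff.mp (right_ne_zero_of_mul hf) c (Finset.mem_univ c)
  refine ⟨WithLp.toLp 2 f, fun h => hf0 (congrFun (congrArg WithLp.ofLp h) 0), ?_⟩
  have hmod : ∀ x : modSet τ l, ∃ m, τ * (l m : ℝ) = x := fun x => by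
    obtain ⟨m, -, hm⟩ := Finset.mem_image.mp x.2
    exact ⟨m, hm⟩
  choose m hm using hmod
  refine isFullSparkFrame_of_linearIndependent ?_ fun S hS => ?_
  · rw [finrank_euclideanSpace, Fintype.card_fin, Fintype.card_prod, ZMod.card, Fintype.card_coe]
    refine Nat.le_mul_of_pos_left _ (Finset.card_pos.mpr ?_)
    exact Finset.univ_nonempty.image _
  · rw [finrank_euclideanSpace, Fintype.card_fin] at hS
    let e : Fin N ≃ S := (Fintype.equivFinOfCardEq (by rw [Fintype.card_coe, hS])).symm
    let c : Fin N → Fin M × ZMod N := fun j => (m (e j).1.1, (e j).1.2)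
    have hc : Function.Injective c := by
      intro i j hij
      have h1 : m (e i).1.1 = m (e j).1.1 := congrArg Prod.fst hij
      have h2 : (e i).1.2 = (e j).1.2 := congrArg (fun p => p.2) hij
      refine e.injective (Subtype.ext (Prod.ext (Subtype.ext ?_) h2))
      rw [← hm, ← hm, h1]
    have hdet := hfP ⟨c, hc⟩
    rw [eval_map_genericMinor] at hdet
    have hli := Matrix.linearIndependent_cols_of_det_ne_zero hdet
    rw [← linearIndependent_equiv e]
    refine LinearIndependent.of_comp (WithLp.linearEquiv 2 ℂ (Fin N → ℂ)).toLinearMap ?_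
    suffices heq : (WithLp.linearEquiv 2 ℂ (Fin N → ℂ)).toLinearMap ∘
        (fun k : S => modShiftFamily ξ (modSet τ l) (WithLp.toLp 2 f) k) ∘ e = Matrix.col
          (Matrix.of fun i j => z ^ (ξ i * l (c j).1) * f (cyclicAdd i (c j).2)) by
      exact heq ▸ hli
    funext j i
    change modShiftFamily ξ (modSet τ l) (WithLp.toLp 2 f) (e j).1 i = _
    rw [modShiftFamily_apply, ← hm, Matrix.col_apply, Matrix.of_apply, hzdef, ← Complex.exp_nat_mul]
    congr 2
    push_cast
    ring
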